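/- **Theorem (Lorentz-Udriște World-Force Law).** Let $M$ be an $n$-dimensional $C^\infty$ manifold with a $C^\infty$ semi-Riemannian metric $g$ with Levi-Civita connection $\nabla$ (components $\Gamma^i_{jk}$), let $X$ be a $C^\infty$ vector field on $M$ with zero set $\mathcal E$, and put $$f=\tfrac12 g(X,X),\qquad F_j{}^i=\nabla_jX^i-g^{ih}g_{kj}\nabla_hX^k .$$ Let $I\subseteq\mathbb R$ be an open interval, $x:I\to M$ a non-constant smooth curve, and suppose that the Hamiltonian $H=\frac12 g\left(\frac{dx}{dt},\frac{dx}{dt}\right)-f(x)$ has the constant value $H_0$ along $x$. Let $U=\{p\in M\setminus\mathcal E:\ H_0+f(p)\neq0\}$ be the open part of $M\setminus\mathcal E$ on which $\bar g=(H_0+f)g$ is a semi-Riemannian metric, and let $J\subseteq I$ be any open interval with $x(J)\subset U$. 1. If $\frac{\nabla}{dt}\frac{dx}{dt}=\operatorname{grad} f$ on $I$, then $x|_J$ is a pregeodesic of the semi-Riemann-Jacobi manifold $(U,\bar g)$, that is, $x|_J$ has a smooth regular reparametrization which is a geodesic of $\bar g$. 2. If $\frac{\nabla}{dt}\frac{dx}{dt}=\operatorname{grad}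 f+F\left(\frac{dx}{dt}\right)$ on $I$, then $x|_J$ is a horizontal pregeodesic of the semi-Riemann-Jacobi-Lagrange manifold $$\left(U,\ \bar g=(H_0+f)g,\ N_j{}^i(x,y)=\Gamma^i_{jk}(x)y^k-F_j{}^i(x)\right).$$ Here a *horizontal pregeodesic* of $(U,\bar g,N)$ is defined as follows. Lift the curve to $TM$ by $t\mapsto(x,y)$, $y=\frac{dx}{dt}$. The nonlinear connection $N$, with $\delta y^i=dy^i+N_j{}^i\,dx^j$, induces along the lift the covariant derivative $\frac{\delta V^i}{dt}=\frac{dV^i}{dt}+N_j{}^i(x,y)V^j$, and $\frac{\delta}{ds}=\frac{dt}{ds}\frac{\delta}{dt}$ for a reparametrization $t=t(s)$. Let $$\bar g_{ij|k}=\frac{\partial \bar g_{ij}}{\partial x^k}-\frac{\partial N_k{}^h}{\partial y^i}\bar g_{hj}-\frac{\partial N_k{}^h}{\partial y^j}\bar g_{ih}$$ be the horizontal covariant derivative of $\bar g$. The curve is a horizontal pregeodesic if it has a smooth regular reparametrization $t=t(s)$ such that, in all charts, $$\frac{\delta}{ds}\frac{dx^i}{ds}+\tfrac12\,\bar g^{il}\left(\bar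 g_{lj|k}+\bar g_{lk|j}-\bar g_{jk|l}\right)\frac{dx^j}{ds}\frac{dx^k}{ds}=0 .$$ (If $N_j{}^i=\Gamma'^{\,i}_{jk}y^k$ comes from a torsion-free linear connection, this is the geodesic equation of $\bar g$.) -/

import Mathlib

open Set Manifold ContDiff Bundle

noncomputable section

/-- A (not necessarily smooth) vector field on an `n`-manifold `M`. -/
abbrev VField (n : ℕ) (M : Type*) [TopologicalSpace M]
    [ChartedSpace (EuclideanSpace ℝ (Fin n)) M] : Type _ :=
  ∀ p : M, TangentSpace (𝓡 n) p

/-- Smoothness of a vector field, as a section of the tangent bundle. -/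
def IsSmoothVField {n : ℕ} {M : Type*} [TopologicalSpace M]
    [ChartedSpace (EuclideanSpace ℝ (Fin n)) M] [IsManifold (𝓡 n) ∞ M] (X : VField n M) : Prop :=
  ContMDiff (𝓡 n) ((𝓡 n).prod 𝓘(ℝ, EuclideanSpace ℝ (Fin n))) ∞
    (fun p ↦ TotalSpace.mk' (EuclideanSpace ℝ (Fin n)) (E := TangentSpace (𝓡 n)) p (X p))

/-- A smooth semi-Riemannian metric on the open subset `U` of the `n`-manifold `M`: a smooth
symmetric `(0,2)`-tensor field which is nondegenerate at each point of `U` (the values outside `U`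
are irrelevant). The signature is locally constant; it is allowed to vary between different
connected components of `U`. -/
structure SemiRiemannianMetric (n : ℕ) (M : Type*) [TopologicalSpace M]
    [ChartedSpace (EuclideanSpace ℝ (Fin n)) M] [IsManifold (𝓡 n) ∞ M] (U : Set M) where
  val : ∀ p : M, TangentSpace (𝓡 n) p →L[ℝ] TangentSpace (𝓡 n) p →L[ℝ] ℝ
  isOpen : IsOpen U
  symm : ∀ p ∈ U, ∀ v w, val p v w = val p w v
  nondegenerate : ∀ p ∈ U, ∀ v, (∀ w, val p v w = 0) → v = 0
  smooth : ContMDiffOn (𝓡 n)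
    ((𝓡 n).prod 𝓘(ℝ, EuclideanSpace ℝ (Fin n) →L[ℝ] EuclideanSpace ℝ (Fin n) →L[ℝ] ℝ)) ∞
    (fun p ↦ TotalSpace.mk'
      (EuclideanSpace ℝ (Fin n) →L[ℝ] EuclideanSpace ℝ (Fin n) →L[ℝ] ℝ)
      (E := fun p : M ↦ TangentSpace (𝓡 n) p →L[ℝ] TangentSpace (𝓡 n) p →L[ℝ] ℝ) p (val p)) U

namespace GeomDyn

variable {n : ℕ} {M : Type*} [TopologicalSpace M] [ChartedSpace (EuclideanSpace ℝ (Fin n)) M]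

/-! ### Local components in a chart `e`, as functions on the open set `e.target` of `ℝⁿ` -/

/-- The partial derivative `∂φ/∂xⁱ` of a real function on `ℝⁿ`. -/
def pd (i : Fin n) (φ : EuclideanSpace ℝ (Fin n) → ℝ) (x : EuclideanSpace ℝ (Fin n)) : ℝ :=
  fderiv ℝ φ x (EuclideanSpace.single i 1)

/-- The coordinate vector `∂/∂xⁱ` of the chart `e`, at the point with coordinates `x`. -/
def frame (e : OpenPartialHomeomorph M (EuclideanSpace ℝ (Fin n))) (i : Fin n)
    (x : EuclideanSpace ℝ (Fin n)) : TangentSpace (𝓡 n) (e.symm x) :=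
  mfderiv (𝓡 n) (𝓡 n) e.symm x (EuclideanSpace.single i (1 : ℝ))

/-- The component `Yⁱ` of a vector field. -/
def vecCoeff (Y : VField n M) (e : OpenPartialHomeomorph M (EuclideanSpace ℝ (Fin n)))
    (i : Fin n) (x : EuclideanSpace ℝ (Fin n)) : ℝ :=
  let v : EuclideanSpace ℝ (Fin n) := mfderiv (𝓡 n) (𝓡 n) e (e.symm x) (Y (e.symm x))
  v i

variable [IsManifold (𝓡 n) ∞ M] {U : Set M}

/-- The matrix `(g_ij)` of components of a metric. -/
def gram (g : SemiRiemannianMetric n M U)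
    (e : OpenPartialHomeomorph M (EuclideanSpace ℝ (Fin n)))
    (x : EuclideanSpace ℝ (Fin n)) : Matrix (Fin n) (Fin n) ℝ :=
  Matrix.of fun i j ↦ g.val (e.symm x) (frame e i x) (frame e j x)

/-- The Christoffel symbols `Γⁱ_jk` of the Levi-Civita connection. -/
def christoffel (g : SemiRiemannianMetric n M U)
    (e : OpenPartialHomeomorph M (EuclideanSpace ℝ (Fin n))) (i j k : Fin n)
    (x : EuclideanSpace ℝ (Fin n)) : ℝ :=
  (1 / 2) * ∑ l, (gram g e x)⁻¹ i l *
    (pd j (fun z ↦ gram g e z l k) x + pd k (fun z ↦ gram g e z l j) x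
      - pd l (fun z ↦ gram g e z j k) x)

/-- `∇_j Yⁱ`, for the Levi-Civita connection. -/
def covDeriv (g : SemiRiemannianMetric n M U) (Y : VField n M)
    (e : OpenPartialHomeomorph M (EuclideanSpace ℝ (Fin n))) (j i : Fin n)
    (x : EuclideanSpace ℝ (Fin n)) : ℝ :=
  pd j (vecCoeff Y e i) x + ∑ k, christoffel g e i j k x * vecCoeff Y e k x

/-- The helicity tensor `F_jⁱ = ∇_j Xⁱ - g^{ih} g_{kj} ∇_h X^k`. -/
def helicity (g : SemiRiemannianMetric n M U) (X : VField n M)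
    (e : OpenPartialHomeomorph M (EuclideanSpace ℝ (Fin n))) (j i : Fin n)
    (x : EuclideanSpace ℝ (Fin n)) : ℝ :=
  covDeriv g X e j i x
    - ∑ h, ∑ k, (gram g e x)⁻¹ i h * gram g e x k j * covDeriv g X e h k x

/-- The component `(grad φ)ⁱ = g^{ih} ∂φ/∂x^h`. -/
def gradCoeff (g : SemiRiemannianMetric n M U) (φ : M → ℝ)
    (e : OpenPartialHomeomorph M (EuclideanSpace ℝ (Fin n))) (i : Fin n)
    (x : EuclideanSpace ℝ (Fin n)) : ℝ :=
  ∑ h, (gram g e x)⁻¹ i h * pd h (fun z ↦ φ (e.symm z)) x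

/-! ### Curves -/

/-- The coordinate `xⁱ` of a curve in the chart `e`. -/
def crd (e : OpenPartialHomeomorph M (EuclideanSpace ℝ (Fin n))) (c : ℝ → M) (i : Fin n)
    (t : ℝ) : ℝ := e (c t) i

/-- The component `(∇/dt dx/dt)ⁱ = d²xⁱ/dt² + Γⁱ_jk dxʲ/dt dxᵏ/dt` of the acceleration of a curve
with respect to the Levi-Civita connection. -/
def accel (g : SemiRiemannianMetric n M U)
    (e : OpenPartialHomeomorph M (EuclideanSpace ℝ (Fin n))) (c : ℝ → M) (i : Fin n)
    (t : ℝ) : ℝ :=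
  deriv (deriv (crd e c i)) t
    + ∑ j, ∑ k, christoffel g e i j k (e (c t)) * deriv (crd e c j) t * deriv (crd e c k) t

/-- `c`, restricted to the open interval `J`, is a geodesic of `(U, g)`. -/
def IsGeodesicOn (g : SemiRiemannianMetric n M U) (c : ℝ → M) (J : Set ℝ) : Prop :=
  ContMDiffOn 𝓘(ℝ, ℝ) (𝓡 n) ∞ c J ∧ MapsTo c J U ∧
    ∀ t ∈ J, ∀ e ∈ IsManifold.maximalAtlas (𝓡 n) ∞ M, c t ∈ e.source →
      ∀ i, accel g e c i t = 0

/-- `τ` is a smooth regular change of parameter from the open interval `J'` onto `J`. -/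
structure IsReparam (τ : ℝ → ℝ) (J' J : Set ℝ) : Prop where
  isOpen : IsOpen J'
  ordConnected : J'.OrdConnected
  smooth : ContDiffOn ℝ ∞ τ J'
  deriv_ne_zero : ∀ s ∈ J', deriv τ s ≠ 0
  image_eq : τ '' J' = J

/-- `c`, restricted to the open interval `J`, is a pregeodesic of `(U, g)`: a smooth curve which
may be reparametrized to be a geodesic. -/
def IsPregeodesicOn (g : SemiRiemannianMetric n M U) (c : ℝ → M) (J : Set ℝ) : Prop :=
  ContMDiffOn 𝓘(ℝ, ℝ) (𝓡 n) ∞ c J ∧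
    ∃ (τ : ℝ → ℝ) (J' : Set ℝ), IsReparam τ J' J ∧ IsGeodesicOn g (c ∘ τ) J'

/-! ### Nonlinear connections on `TM` and horizontal pregeodesics -/

/-- The local coefficients of a nonlinear connection on `TM`: `N e j i x y` is `N_jⁱ(x,y)` in the
chart `(xⁱ,yⁱ)` of `TM` induced by the chart `e` of `M`; the horizontal distribution is given by
`δyⁱ = dyⁱ + N_jⁱ(x,y) dxʲ = 0`. -/
abbrev NCoeff (n : ℕ) (M : Type*) [TopologicalSpace M] : Type _ :=
  OpenPartialHomeomorph M (EuclideanSpace ℝ (Fin n)) → Fin n → Fin n →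
    EuclideanSpace ℝ (Fin n) → EuclideanSpace ℝ (Fin n) → ℝ

/-- The horizontal covariant derivative (for the Berwald connection `∂N_kʰ/∂yⁱ` of `N`) of a
metric `g_ij(x)`:
`g_{ij|k} = ∂g_ij/∂xᵏ - (∂N_kʰ/∂yⁱ) g_hj - (∂N_kʰ/∂yʲ) g_ih`. -/
def hDeriv (g : SemiRiemannianMetric n M U) (N : NCoeff n M)
    (e : OpenPartialHomeomorph M (EuclideanSpace ℝ (Fin n))) (i j k : Fin n)
    (x y : EuclideanSpace ℝ (Fin n)) : ℝ :=
  pd k (fun z ↦ gram g e z i j) x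
    - ∑ h, pd i (fun w ↦ N e k h x w) y * gram g e x h j
    - ∑ h, pd j (fun w ↦ N e k h x w) y * gram g e x i h

/-- `½ g^{il} (g_{lj|k} + g_{lk|j} - g_{jk|l})`. -/
def hChristoffel (g : SemiRiemannianMetric n M U) (N : NCoeff n M)
    (e : OpenPartialHomeomorph M (EuclideanSpace ℝ (Fin n))) (i j k : Fin n)
    (x y : EuclideanSpace ℝ (Fin n)) : ℝ :=
  (1 / 2) * ∑ l, (gram g e x)⁻¹ i l *
    (hDeriv g N e l j k x y + hDeriv g N e l k j x y - hDeriv g N e j k l x y)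

/-- The velocity `y = dx/dt` of a curve, in the chart `e`; `(x, y)` is the lift of the curve
to `TM`. -/
def velCrd (e : OpenPartialHomeomorph M (EuclideanSpace ℝ (Fin n))) (c : ℝ → M)
    (t : ℝ) : EuclideanSpace ℝ (Fin n) := deriv (fun r ↦ e (c r)) t

/-- The components of the horizontal acceleration of `x(s) = c (τ s)`, computed along the lift
`(x, y)`, `y = dx/dt`, `t = τ s`, of the curve `c` to `TM`:
`δ/ds (dx/ds)ⁱ + ½ g^{il} (g_{lj|k} + g_{lk|j} - g_{jk|l})(x,y) dxʲ/ds dxᵏ/ds`, where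
`δVⁱ/ds = dVⁱ/ds + (dt/ds) N_jⁱ(x,y) Vʲ` is the covariant derivative along the lift induced by `N`,
that is `dt/ds` times `δVⁱ/dt = dVⁱ/dt + N_jⁱ(x,y) Vʲ`; in particular
`δyⁱ/dt = dyⁱ/dt + N_jⁱ(x,y) dxʲ/dt`. -/
def hAccel (g : SemiRiemannianMetric n M U) (N : NCoeff n M)
    (e : OpenPartialHomeomorph M (EuclideanSpace ℝ (Fin n))) (c : ℝ → M) (τ : ℝ → ℝ) (i : Fin n)
    (s : ℝ) : ℝ :=
  deriv (deriv (crd e (c ∘ τ) i)) s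
    + deriv τ s * ∑ j, N e j i (e (c (τ s))) (velCrd e c (τ s)) * deriv (crd e (c ∘ τ) j) s
    + ∑ j, ∑ k, hChristoffel g N e i j k (e (c (τ s))) (velCrd e c (τ s))
        * deriv (crd e (c ∘ τ) j) s * deriv (crd e (c ∘ τ) k) s

/-- `c`, restricted to the open interval `J`, is a horizontal pregeodesic of `(U, g, N)`: it has a
smooth regular reparametrization whose horizontal acceleration vanishes. -/
def IsHorizontalPregeodesicOn (g : SemiRiemannianMetric n M U) (N : NCoeff n M) (c : ℝ → M)
    (J : Set ℝ) : Prop :=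
  ContMDiffOn 𝓘(ℝ, ℝ) (𝓡 n) ∞ c J ∧ MapsTo c J U ∧
    ∃ (τ : ℝ → ℝ) (J' : Set ℝ), IsReparam τ J' J ∧
      ∀ s ∈ J', ∀ e ∈ IsManifold.maximalAtlas (𝓡 n) ∞ M, c (τ s) ∈ e.source →
        ∀ i, hAccel g N e c τ i s = 0

/-! ### Geometric dynamics of a vector field -/

/-- The energy `f = ½ g(X,X)` of the vector field `X`. -/
def energy (g : SemiRiemannianMetric n M univ) (X : VField n M) (p : M) : ℝ :=
  (1 / 2) * g.val p (X p) (X p)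

/-- The velocity `dx/dt ∈ T_{x(t)} M` of a curve. -/
def velocity (c : ℝ → M) (t : ℝ) : TangentSpace (𝓡 n) (c t) :=
  mfderiv 𝓘(ℝ, ℝ) (𝓡 n) c t (1 : ℝ)

/-- The Hamiltonian `H = ½ g(dx/dt, dx/dt) - f(x)` along a curve. -/
def hamiltonian (g : SemiRiemannianMetric n M univ) (X : VField n M) (c : ℝ → M) (t : ℝ) : ℝ :=
  (1 / 2) * g.val (c t) (velocity c t) (velocity c t) - energy g X (c t)

/-- `c` is on the open interval `I` a trajectory of `∇/dt dx/dt = grad f`. -/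
def IsPotentialTrajectory (g : SemiRiemannianMetric n M univ) (X : VField n M) (c : ℝ → M)
    (I : Set ℝ) : Prop :=
  ContMDiffOn 𝓘(ℝ, ℝ) (𝓡 n) ∞ c I ∧
    ∀ t ∈ I, ∀ e ∈ IsManifold.maximalAtlas (𝓡 n) ∞ M, c t ∈ e.source →
      ∀ i, accel g e c i t = gradCoeff g (energy g X) e i (e (c t))

/-- `c` is on the open interval `I` a trajectory of `∇/dt dx/dt = grad f + F(dx/dt)`. -/
def IsNonPotentialTrajectory (g : SemiRiemannianMetric n M univ) (X : VField n M) (c : ℝ → M)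
    (I : Set ℝ) : Prop :=
  ContMDiffOn 𝓘(ℝ, ℝ) (𝓡 n) ∞ c I ∧
    ∀ t ∈ I, ∀ e ∈ IsManifold.maximalAtlas (𝓡 n) ∞ M, c t ∈ e.source →
      ∀ i, accel g e c i t = gradCoeff g (energy g X) e i (e (c t))
        + ∑ j, helicity g X e j i (e (c t)) * deriv (crd e c j) t

/-- The nonlinear connection `N_jⁱ = Γⁱ_jk yᵏ - F_jⁱ`, where `Γⁱ_jk` are the components of the
Levi-Civita connection of `g`. -/
def lorentzN (g : SemiRiemannianMetric n M univ) (X : VField n M) : NCoeff n M :=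
  fun e j i x y ↦ ∑ k, christoffel g e i j k x * y k - helicity g X e j i x

/-- The part of `M ∖ 𝓔`, where `𝓔` is the set of zeros of `X`, on which `H₀ + f ≠ 0`, i.e. on which
`(H₀ + f) g` is nondegenerate. -/
def jacobiDomain (g : SemiRiemannianMetric n M univ) (X : VField n M) (H₀ : ℝ) : Set M :=
  {p | X p ≠ 0 ∧ H₀ + energy g X p ≠ 0}


theorem energy_smooth (g : SemiRiemannianMetric n M univ) (X : VField n M)
    (hX : IsSmoothVField X) : ContMDiff (𝓡 n) 𝓘(ℝ, ℝ) ∞ (energy g X) := by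
  have hg := contMDiffOn_univ.1 g.smooth
  have h := ContMDiff.clm_bundle_apply₂ (F₁ := EuclideanSpace ℝ (Fin n))
    (F₂ := EuclideanSpace ℝ (Fin n)) (F₃ := ℝ)
    (E₁ := (TangentSpace (𝓡 n) : M → Type _)) (E₂ := (TangentSpace (𝓡 n) : M → Type _))
    (E₃ := Bundle.Trivial M ℝ) (b := fun p : M ↦ p) (IB := 𝓡 n) (IM := 𝓡 n) (n := ∞)
    (ψ := g.val) hg hX hX
  have h2 : ContMDiff (𝓡 n) 𝓘(ℝ, ℝ) ∞ (fun p ↦ g.val p (X p) (X p)) := by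
    intro p
    have := h p
    simp only [contMDiffAt_section] at this
    exact this
  exact contMDiff_const.mul h2

theorem isOpen_ne_zero (X : VField n M) (hX : IsSmoothVField X) : IsOpen {p : M | X p ≠ 0} := by
  rw [isOpen_iff_mem_nhds]
  intro p hp
  have hc := hX.continuous
  set T := trivializationAt (EuclideanSpace ℝ (Fin n)) (TangentSpace (𝓡 n) : M → Type _) p
  have hpT : p ∈ T.baseSet := FiberBundle.mem_baseSet_trivializationAt' p
  have key : ∀ q (hq : q ∈ T.baseSet), (T ⟨q, X q⟩).2 = T.continuousLinearEquivAt ℝ q hq (X q) :=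
    fun q hq ↦ rfl
  have hcont : ContinuousAt (fun q ↦ (T ⟨q, X q⟩).2) p := by
    have h1 : ContinuousAt T (⟨p, X p⟩ : TotalSpace (EuclideanSpace ℝ (Fin n)) (TangentSpace (𝓡 n))) :=
      T.continuousAt (T.mem_source.2 hpT)
    exact continuous_snd.continuousAt.comp
      (ContinuousAt.comp (f := fun q ↦ (⟨q, X q⟩ : TotalSpace (EuclideanSpace ℝ (Fin n))
        (TangentSpace (𝓡 n) : M → Type _))) h1 hc.continuousAt)
  have hne : (T ⟨p, X p⟩).2 ≠ 0 := by
    rw [key p hpT]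
    exact (T.continuousLinearEquivAt ℝ p hpT).map_ne_zero_iff.2 hp
  filter_upwards [hcont.eventually_ne hne, T.open_baseSet.mem_nhds hpT] with q hq hqT hq0
  rw [key q hqT, hq0] at hq
  exact hq (map_zero (T.continuousLinearEquivAt ℝ q hqT))

/-- The semi-Riemannian metric `ḡ = (H₀ + f) g`. -/
def jacobiMetric (g : SemiRiemannianMetric n M univ) (X : VField n M) (hX : IsSmoothVField X)
    (H₀ : ℝ) : SemiRiemannianMetric n M (jacobiDomain g X H₀) where
  val p := (H₀ + energy g X p) • g.val p
  isOpen := (isOpen_ne_zero X hX).inter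
    (isOpen_ne_fun (continuous_const.add (energy_smooth g X hX).continuous) continuous_const)
  symm p _ v w := by simp [g.symm p (mem_univ p) v w]
  nondegenerate p hp v hv := g.nondegenerate p (mem_univ p) v fun w ↦ by
    have := hv w
    simp only [smul_apply, smul_eq_mul, mul_eq_zero] at this
    exact this.resolve_left hp.2
  smooth := by
    have hf : ContMDiff (𝓡 n) 𝓘(ℝ, ℝ) ∞ (fun p ↦ H₀ + energy g X p) :=
      contMDiff_const.add (energy_smooth g X hX)
    exact ContMDiffOn.smul_section hf.contMDiffOn (g.smooth.mono (subset_univ _))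

end GeomDyn

end

/-! ### Changes of parameter with prescribed speed -/

section

open scoped Topology

/-! Write h = H₀ + f and v = dx/dt. The connection coefficients of hg differ from those of g by
(1/2h)(δⁱ_j ∂_k f + δⁱ_k ∂_j f - g_jk gradⁱ f). Evaluated on (v, v), and using g(v, v) = 2h on the
energy level, this equals (h'/h) v - grad f (`sum_jacobi_correction_of_hamiltonian`). The term -grad
f cancels the force, so the acceleration for hg is the tangential vector (h'/h) v. The parameter s
with dt/ds = 1/h removes it: the chain rule contributes -(h'/h³) v to d²x/ds², while all other terms
scale by h⁻². In the second case F does not depend on y, so ∂N/∂y is the Levi-Civita connection of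
g, for which g is parallel. Only the derivative of h survives in the horizontal derivative of hg,
and `hChristoffel_jacobiMetric` gives exactly the same correction term. The Γ and F terms of the
equation of motion are now supplied by δ/ds, and the same cancellation applies with the same
parameter. -/

theorem exists_isReparam_hasDerivAt_inv {J : Set ℝ} (hJ : IsOpen J) (hJ' : J.OrdConnected)
    {h : ℝ → ℝ} (hh : ContDiffOn ℝ ∞ h J) (h0 : ∀ t ∈ J, h t ≠ 0) :
    ∃ (τ : ℝ → ℝ) (J' : Set ℝ), GeomDyn.IsReparam τ J' J ∧
      ∀ s ∈ J', HasDerivAt τ (h (τ s))⁻¹ s := by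
  rcases J.eq_empty_or_nonempty with rfl | ⟨a, ha⟩
  · exact ⟨id, ∅, ⟨isOpen_empty, ordConnected_empty, contDiffOn_empty, by simp, by simp⟩, by simp⟩
  -- The new parameter as a function of the old one, s = σ(t) with ds/dt = h; `τ` will be its
  -- inverse.
  set σ : ℝ → ℝ := fun t ↦ ∫ u in a..t, h u with hσ
  have hder : ∀ t ∈ J, HasStrictDerivAt σ (h t) t := fun t ht ↦
    intervalIntegral.integral_hasStrictDerivAt_right
      ((hh.continuousOn.mono (hJ'.uIcc_subset ha ht)).intervalIntegrable)
      (hh.continuousOn.stronglyMeasurableAtFilter hJ t ht)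
      (hh.continuousOn.continuousAt (hJ.mem_nhds ht))
  have hsm : ContDiffOn ℝ ∞ σ J := by
    rw [contDiffOn_infty_iff_deriv_of_isOpen hJ]
    exact ⟨fun t ht ↦ (hder t ht).hasDerivAt.differentiableAt.differentiableWithinAt,
      hh.congr fun t ht ↦ (hder t ht).hasDerivAt.deriv⟩
  -- By Rolle, two equal values of σ would force a zero of `h`; the sign of `h` need not be known.
  have hinj : InjOn σ J := by
    have key : ∀ x ∈ J, ∀ y ∈ J, x < y → σ x ≠ σ y := by
      intro x hx y hy hxy he
      have hsub : Icc x y ⊆ J := hJ'.out hx hy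
      obtain ⟨z, hz, hz0⟩ := exists_hasDerivAt_eq_zero hxy (hsm.continuousOn.mono hsub) he
        fun z hz ↦ (hder z (hsub (Ioo_subset_Icc_self hz))).hasDerivAt
      exact h0 z (hsub (Ioo_subset_Icc_self hz)) hz0
    intro x hx y hy he
    by_contra hne
    rcases lt_or_gt_of_ne hne with hlt | hlt
    · exact key x hx y hy hlt he
    · exact key y hy x hx hlt he.symm
  -- A nonzero strict derivative makes σ locally open, by the inverse function theorem.
  have hopen : IsOpenMap (J.domRestrict σ) := by
    rw [isOpenMap_iff_nhds_le]
    rintro ⟨t, ht⟩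
    have h1 := (hder t ht).map_nhds_eq (h0 t ht)
    change 𝓝 (σ t) ≤ Filter.map (σ ∘ Subtype.val) (𝓝 ⟨t, ht⟩)
    rw [← Filter.map_map, map_nhds_subtype_coe_eq_nhds ht (hJ.mem_nhds ht), h1]
  let T : OpenPartialHomeomorph ℝ ℝ := OpenPartialHomeomorph.ofContinuousOpenRestrict
    hinj.toPartialEquiv hsm.continuousOn hopen hJ
  have hT : ∀ s ∈ T.target, HasDerivAt T.symm (h (T.symm s))⁻¹ s := fun s hs ↦
    T.hasDerivAt_symm hs (h0 _ (T.map_target hs)) (hder _ (T.map_target hs)).hasDerivAt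
  refine ⟨T.symm, T.target, ⟨T.open_target, ?_, ?_, ?_, ?_⟩, hT⟩
  · have : T.target = σ '' J := T.image_source_eq_target.symm
    rw [this]
    exact (hJ'.isPreconnected.image σ hsm.continuousOn).ordConnected
  · exact fun s hs ↦ (T.contDiffAt_symm_deriv (h0 _ (T.map_target hs)) hs
      (hder _ (T.map_target hs)).hasDerivAt
      (hsm.contDiffAt (hJ.mem_nhds (T.map_target hs)))).contDiffWithinAt
  · exact fun s hs ↦ (hT s hs).deriv ▸ inv_ne_zero (h0 _ (T.map_target hs))
  · exact T.symm_image_target_eq_source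

/-! ### Metric components in a chart -/

namespace GeomDyn

variable {n : ℕ} {M : Type*} [TopologicalSpace M] [ChartedSpace (EuclideanSpace ℝ (Fin n)) M]
  {U : Set M} {e : OpenPartialHomeomorph M (EuclideanSpace ℝ (Fin n))}

theorem mdifferentiable_of_mem_maximalAtlas (he : e ∈ IsManifold.maximalAtlas (𝓡 n) ∞ M) :
    e.MDifferentiable (𝓡 n) (𝓡 n) :=
  ⟨(contMDiffOn_of_mem_maximalAtlas he).mdifferentiableOn (by simp),
    (contMDiffOn_symm_of_mem_maximalAtlas he).mdifferentiableOn (by simp)⟩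

theorem differentiableAt_comp_symm (he : e ∈ IsManifold.maximalAtlas (𝓡 n) ∞ M) {φ : M → ℝ}
    (hφ : ContMDiff (𝓡 n) 𝓘(ℝ, ℝ) ∞ φ) {x : EuclideanSpace ℝ (Fin n)} (hx : x ∈ e.target) :
    DifferentiableAt ℝ (fun z ↦ φ (e.symm z)) x :=
  (((hφ.comp_contMDiffOn (contMDiffOn_symm_of_mem_maximalAtlas he)).contMDiffAt
    (e.open_target.mem_nhds hx)).mdifferentiableAt (by simp)).differentiableAt

theorem mfderiv_symm_eq_sum_frame (v x : EuclideanSpace ℝ (Fin n)) :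
    (mfderiv (𝓡 n) (𝓡 n) e.symm x v : TangentSpace (𝓡 n) (e.symm x)) =
      ∑ i, v i • frame e i x := by
  have hv : v = ∑ i, v i • EuclideanSpace.single i (1 : ℝ) := by
    ext j
    simp [Finset.sum_apply, Pi.single_apply]
  let D : EuclideanSpace ℝ (Fin n) →L[ℝ] EuclideanSpace ℝ (Fin n) :=
    mfderiv (𝓡 n) (𝓡 n) e.symm x
  change D v = ∑ i, v i • D (EuclideanSpace.single i (1 : ℝ))
  conv_lhs => rw [hv]
  simp only [map_sum, map_smul]

variable [IsManifold (𝓡 n) ∞ M]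

/-- The coordinate field is the tangent map of `e.symm` applied to a constant section, hence smooth;
this is what makes the g_ij differentiable. -/
theorem contMDiffOn_frame (he : e ∈ IsManifold.maximalAtlas (𝓡 n) ∞ M) (i : Fin n) :
    ContMDiffOn (𝓡 n) ((𝓡 n).prod 𝓘(ℝ, EuclideanSpace ℝ (Fin n))) ∞
      (fun x ↦ TotalSpace.mk' (EuclideanSpace ℝ (Fin n)) (E := (TangentSpace (𝓡 n) : M → Type _))
        (e.symm x) (frame e i x)) e.target := by
  have h1 := (contMDiffOn_symm_of_mem_maximalAtlas he).contMDiffOn_tangentMapWithin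
    (m := ∞) (by simp) e.open_target.uniqueMDiffOn
  have h2 : ContMDiff (𝓡 n) ((𝓡 n).prod 𝓘(ℝ, EuclideanSpace ℝ (Fin n))) ∞
      (fun x : EuclideanSpace ℝ (Fin n) ↦
        (⟨x, EuclideanSpace.single i (1 : ℝ)⟩ :
          TangentBundle (𝓡 n) (EuclideanSpace ℝ (Fin n)))) :=
    contMDiff_vectorSpace_iff_contDiff.2 contDiff_const
  refine (h1.comp h2.contMDiffOn (fun x hx ↦ hx)).congr fun x hx ↦ ?_
  simp [tangentMapWithin, frame, mfderivWithin_of_isOpen e.open_target hx]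

theorem differentiableAt_gram (g : SemiRiemannianMetric n M univ)
    (he : e ∈ IsManifold.maximalAtlas (𝓡 n) ∞ M) (i j : Fin n) {x : EuclideanSpace ℝ (Fin n)}
    (hx : x ∈ e.target) : DifferentiableAt ℝ (fun z ↦ gram g e z i j) x := by
  have hs := contMDiffOn_symm_of_mem_maximalAtlas he
  have hg := (contMDiffOn_univ.1 g.smooth).comp_contMDiffOn hs
  have h := ContMDiffOn.clm_bundle_apply₂ (F₁ := EuclideanSpace ℝ (Fin n))
    (F₂ := EuclideanSpace ℝ (Fin n)) (F₃ := ℝ)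
    (E₁ := (TangentSpace (𝓡 n) : M → Type _)) (E₂ := (TangentSpace (𝓡 n) : M → Type _))
    (E₃ := Bundle.Trivial M ℝ) (b := fun x ↦ e.symm x) (IB := 𝓡 n) (IM := 𝓡 n) (n := ∞)
    (ψ := fun x ↦ g.val (e.symm x)) hg (contMDiffOn_frame he i) (contMDiffOn_frame he j)
  have h2 : ContMDiffAt (𝓡 n) 𝓘(ℝ, ℝ) ∞ (fun z ↦ gram g e z i j) x := by
    have := (h x hx).contMDiffAt (e.open_target.mem_nhds hx)
    simp only [contMDiffAt_totalSpace] at this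
    exact this.2
  exact (h2.mdifferentiableAt (by simp)).differentiableAt

theorem val_sum_frame (g : SemiRiemannianMetric n M U) (v w x : EuclideanSpace ℝ (Fin n)) :
    g.val (e.symm x) (∑ i, v i • frame e i x) (∑ j, w j • frame e j x) =
      ∑ i, ∑ j, gram g e x i j * v i * w j := by
  simp only [map_sum, map_smul, sum_apply, smul_apply,
    smul_eq_mul, gram, Matrix.of_apply, Finset.mul_sum]
  rw [Finset.sum_comm]
  refine Finset.sum_congr rfl fun i _ ↦ Finset.sum_congr rfl fun j _ ↦ by ring

theorem gram_symm (g : SemiRiemannianMetric n M univ) (x : EuclideanSpace ℝ (Fin n))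
    (i j : Fin n) : gram g e x i j = gram g e x j i :=
  g.symm _ (mem_univ _) _ _

/-- The differential of `e.symm` is bijective, so a kernel vector of the Gram matrix would give a
nonzero tangent vector orthogonal to the whole tangent space. -/
theorem isUnit_det_gram (g : SemiRiemannianMetric n M univ)
    (he : e ∈ IsManifold.maximalAtlas (𝓡 n) ∞ M) {x : EuclideanSpace ℝ (Fin n)}
    (hx : x ∈ e.target) : IsUnit (gram g e x).det := by
  rw [isUnit_iff_ne_zero]
  intro hdet
  obtain ⟨v, hv, hv0⟩ := Matrix.exists_mulVec_eq_zero_iff.2 hdet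
  have hm := mdifferentiable_of_mem_maximalAtlas he
  let v' : EuclideanSpace ℝ (Fin n) := WithLp.toLp 2 v
  have hw := mfderiv_symm_eq_sum_frame (e := e) v' x
  refine hv ?_
  have h0 : (mfderiv (𝓡 n) (𝓡 n) e.symm x v' : TangentSpace (𝓡 n) (e.symm x)) = 0 := by
    refine g.nondegenerate _ (mem_univ _) _ fun w ↦ ?_
    obtain ⟨w', rfl⟩ : ∃ w' : EuclideanSpace ℝ (Fin n),
        mfderiv (𝓡 n) (𝓡 n) e.symm x w' = w := hm.symm.mfderiv_surjective hx w
    rw [hw, mfderiv_symm_eq_sum_frame w' x, val_sum_frame, Finset.sum_comm]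
    refine Finset.sum_eq_zero fun j _ ↦ ?_
    have := congrFun hv0 j
    simp only [Matrix.mulVec, dotProduct, Pi.zero_apply] at this
    rw [← Finset.sum_mul]
    simp_rw [gram_symm g x _ j]
    exact mul_eq_zero_of_left this _
  have h1 : v' = 0 := hm.symm.mfderiv_injective hx (h0.trans (map_zero _).symm)
  ext i
  exact congrArg (fun u : EuclideanSpace ℝ (Fin n) ↦ u i) h1

end GeomDyn

/-! ### Pointwise algebra and the second-order chain rule -/

/-- Here `p` plays the role of df and `v` of the velocity. In the first two terms G⁻¹G contracts to
δ, giving two equal multiples of `v`; the third gives the gradient times the square of `v`. -/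
theorem sum_conformal_christoffel_mul_mul {n : ℕ} {G : Matrix (Fin n) (Fin n) ℝ}
    (hG : IsUnit G.det) (v p : Fin n → ℝ) (i : Fin n) :
    ∑ j, ∑ k, (∑ l, G⁻¹ i l * (p k * G l j + p j * G l k - p l * G j k)) * v j * v k =
      2 * v i * ∑ k, p k * v k - (∑ j, ∑ k, G j k * v j * v k) * ∑ l, G⁻¹ i l * p l := by
  have hδ : ∀ j, ∑ l, G⁻¹ i l * G l j = if i = j then 1 else 0 := fun j ↦ by
    rw [← Matrix.mul_apply, Matrix.nonsing_inv_mul G hG, Matrix.one_apply]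
  have h1 : ∀ j k, (∑ l, G⁻¹ i l * (p k * G l j + p j * G l k - p l * G j k)) * v j * v k =
      (if i = j then v j else 0) * (p k * v k) + (p j * v j) * (if i = k then v k else 0)
        - (G j k * v j * v k) * ∑ l, G⁻¹ i l * p l := fun j k ↦ by
    have : ∑ l, G⁻¹ i l * (p k * G l j + p j * G l k - p l * G j k) =
        p k * ∑ l, G⁻¹ i l * G l j + p j * ∑ l, G⁻¹ i l * G l k
          - G j k * ∑ l, G⁻¹ i l * p l := by
      simp only [Finset.mul_sum, ← Finset.sum_add_distrib, ← Finset.sum_sub_distrib]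
      exact Finset.sum_congr rfl fun l _ ↦ by ring
    rw [this, hδ, hδ]
    split_ifs <;> ring
  simp only [h1, Finset.sum_sub_distrib, Finset.sum_add_distrib, ← Finset.mul_sum,
    ← Finset.sum_mul, Finset.sum_ite_eq, Finset.mem_univ, if_true]
  ring

/-- The source of the tangential term -(h'/h³) dx/dt: differentiating 1/h(τ(s)) gives -h'/h² times
dτ/ds = 1/h. -/
theorem deriv_comp_of_hasDerivAt_inv {x h τ : ℝ → ℝ} {s : ℝ} (hx : ContDiffAt ℝ ∞ x (τ s))
    (hh : DifferentiableAt ℝ h (τ s)) (h0 : h (τ s) ≠ 0)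
    (hτ : ∀ᶠ r in 𝓝 s, HasDerivAt τ (h (τ r))⁻¹ r) :
    deriv (x ∘ τ) s = deriv x (τ s) * (h (τ s))⁻¹ ∧
    deriv (deriv (x ∘ τ)) s = deriv (deriv x) (τ s) * (h (τ s))⁻¹ ^ 2
      - deriv x (τ s) * deriv h (τ s) * (h (τ s))⁻¹ ^ 3 := by
  have hτs := hτ.self_of_nhds
  have hx1 : ∀ᶠ r in 𝓝 (τ s), DifferentiableAt ℝ x r := by
    filter_upwards [(hx.of_le (m := 1) (by simp)).eventually
      (by exact_mod_cast ENat.one_ne_top)] with r hr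
    exact hr.differentiableAt (by simp)
  have hev : deriv (x ∘ τ) =ᶠ[𝓝 s] fun r ↦ deriv x (τ r) * (h (τ r))⁻¹ := by
    filter_upwards [hτ, hτs.continuousAt.eventually hx1] with r hr hr1
    exact (hr1.hasDerivAt.comp r hr).deriv
  refine ⟨hev.self_of_nhds, ?_⟩
  have hx2 : DifferentiableAt ℝ (deriv x) (τ s) :=
    (hx.derivWithin (m := ∞) (by simp)).differentiableAt (by simp)
  have h3 := (hx2.hasDerivAt.comp s hτs).mul ((hh.hasDerivAt.comp s hτs).inv h0)
  rw [hev.deriv_eq]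
  refine (h3.deriv).trans ?_
  simp only [Pi.inv_apply, Function.comp_apply]
  field_simp
  ring

/-! ### Curves and velocities in a chart -/

namespace GeomDyn

theorem eventuallyEq_symm_comp {n : ℕ} {M : Type*} [TopologicalSpace M]
    {e : OpenPartialHomeomorph M (EuclideanSpace ℝ (Fin n))} {c : ℝ → M} {t : ℝ} (hc : ContinuousAt c t)
    (ht : c t ∈ e.source) : c =ᶠ[𝓝 t] fun r ↦ e.symm (e (c r)) := by
  filter_upwards [hc.eventually (e.open_source.mem_nhds ht)] with r hr
  exact (e.left_inv hr).symm

variable {n : ℕ} {M : Type*} [TopologicalSpace M] [ChartedSpace (EuclideanSpace ℝ (Fin n)) M]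
  {e : OpenPartialHomeomorph M (EuclideanSpace ℝ (Fin n))}

theorem fderiv_apply_eq_sum_pd (φ : EuclideanSpace ℝ (Fin n) → ℝ)
    (x v : EuclideanSpace ℝ (Fin n)) : fderiv ℝ φ x v = ∑ k, pd k φ x * v k := by
  have hv : v = ∑ i, v i • EuclideanSpace.single i (1 : ℝ) := by
    ext j
    simp [Finset.sum_apply, Pi.single_apply]
  conv_lhs => rw [hv]
  simp [pd, mul_comm]

theorem pd_mul {φ ψ : EuclideanSpace ℝ (Fin n) → ℝ} {x : EuclideanSpace ℝ (Fin n)}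
    (hφ : DifferentiableAt ℝ φ x) (hψ : DifferentiableAt ℝ ψ x) (k : Fin n) :
    pd k (fun z ↦ φ z * ψ z) x = pd k φ x * ψ x + φ x * pd k ψ x := by
  unfold pd
  rw [(hφ.hasFDerivAt.fun_mul hψ.hasFDerivAt).fderiv]
  simp
  ring

theorem contDiffAt_chart_comp (he : e ∈ IsManifold.maximalAtlas (𝓡 n) ∞ M) {c : ℝ → M} {t : ℝ}
    (hc : ContMDiffAt 𝓘(ℝ, ℝ) (𝓡 n) ∞ c t) (ht : c t ∈ e.source) :
    ContDiffAt ℝ ∞ (fun r ↦ e (c r)) t :=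
  (((contMDiffOn_of_mem_maximalAtlas he).contMDiffAt
    (e.open_source.mem_nhds ht)).comp t hc).contDiffAt

theorem deriv_crd (he : e ∈ IsManifold.maximalAtlas (𝓡 n) ∞ M) {c : ℝ → M} {t : ℝ}
    (hc : ContMDiffAt 𝓘(ℝ, ℝ) (𝓡 n) ∞ c t) (ht : c t ∈ e.source) (i : Fin n) :
    deriv (crd e c i) t = velCrd e c t i := by
  have h := ((contDiffAt_chart_comp he hc ht).differentiableAt (by simp)).hasDerivAt
  exact ((EuclideanSpace.proj i : EuclideanSpace ℝ (Fin n) →L[ℝ] ℝ).hasFDerivAt.comp_hasDerivAt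
    t h).deriv

theorem contDiffAt_crd (he : e ∈ IsManifold.maximalAtlas (𝓡 n) ∞ M) {c : ℝ → M} {t : ℝ}
    (hc : ContMDiffAt 𝓘(ℝ, ℝ) (𝓡 n) ∞ c t) (ht : c t ∈ e.source) (i : Fin n) :
    ContDiffAt ℝ ∞ (crd e c i) t :=
  (EuclideanSpace.proj i : EuclideanSpace ℝ (Fin n) →L[ℝ] ℝ).contDiff.contDiffAt.comp t
    (contDiffAt_chart_comp he hc ht)

theorem deriv_comp_curve (he : e ∈ IsManifold.maximalAtlas (𝓡 n) ∞ M) {φ : M → ℝ}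
    (hφ : ContMDiff (𝓡 n) 𝓘(ℝ, ℝ) ∞ φ) {c : ℝ → M} {t : ℝ}
    (hc : ContMDiffAt 𝓘(ℝ, ℝ) (𝓡 n) ∞ c t) (ht : c t ∈ e.source) :
    deriv (fun r ↦ φ (c r)) t =
      ∑ k, pd k (fun z ↦ φ (e.symm z)) (e (c t)) * velCrd e c t k := by
  have h := ((contDiffAt_chart_comp he hc ht).differentiableAt (by simp)).hasDerivAt
  have h1 := (differentiableAt_comp_symm he hφ (e.map_source ht)).hasFDerivAt.comp_hasDerivAt t h
  rw [← fderiv_apply_eq_sum_pd]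
  have h2 : (fun r ↦ φ (c r)) =ᶠ[𝓝 t] (fun z ↦ φ (e.symm z)) ∘ (fun r ↦ e (c r)) :=
    (eventuallyEq_symm_comp hc.continuousAt ht).fun_comp φ
  rw [h2.deriv_eq]
  exact h1.deriv

theorem velocity_eq_mfderiv_symm (he : e ∈ IsManifold.maximalAtlas (𝓡 n) ∞ M) {c : ℝ → M} {t : ℝ}
    (hc : ContMDiffAt 𝓘(ℝ, ℝ) (𝓡 n) ∞ c t) (ht : c t ∈ e.source) :
    (velocity c t : EuclideanSpace ℝ (Fin n)) =
      (mfderiv (𝓡 n) (𝓡 n) e.symm (e (c t)) (velCrd e c t) : EuclideanSpace ℝ (Fin n)) := by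
  have h := (contDiffAt_chart_comp he hc ht).differentiableAt (by simp)
  have h1 : mfderiv 𝓘(ℝ, ℝ) (𝓡 n) (e.symm ∘ (fun r ↦ e (c r))) t =
      (mfderiv (𝓡 n) (𝓡 n) e.symm (e (c t))).comp
        (mfderiv 𝓘(ℝ, ℝ) (𝓡 n) (fun r ↦ e (c r)) t) :=
    mfderiv_comp t ((mdifferentiable_of_mem_maximalAtlas he).mdifferentiableAt_symm
      (e.map_source ht)) h.mdifferentiableAt
  have h2 : mfderiv 𝓘(ℝ, ℝ) (𝓡 n) c t = (mfderiv 𝓘(ℝ, ℝ) (𝓡 n) (e.symm ∘ (fun r ↦ e (c r))) t :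
      ℝ →L[ℝ] EuclideanSpace ℝ (Fin n)) :=
    (eventuallyEq_symm_comp hc.continuousAt ht).mfderiv_eq
  have h3 : mfderiv 𝓘(ℝ, ℝ) (𝓡 n) (fun r ↦ e (c r)) t = fderiv ℝ (fun r ↦ e (c r)) t :=
    mfderiv_eq_fderiv
  have h4 := congrArg (fun L : ℝ →L[ℝ] EuclideanSpace ℝ (Fin n) ↦ L 1) (h2.trans h1)
  refine h4.trans ?_
  rw [h3]
  rfl

variable [IsManifold (𝓡 n) ∞ M]

theorem val_velocity (g : SemiRiemannianMetric n M univ)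
    (he : e ∈ IsManifold.maximalAtlas (𝓡 n) ∞ M) {c : ℝ → M} {t : ℝ}
    (hc : ContMDiffAt 𝓘(ℝ, ℝ) (𝓡 n) ∞ c t) (ht : c t ∈ e.source) :
    g.val (c t) (velocity c t) (velocity c t) =
      ∑ j, ∑ k, gram g e (e (c t)) j k * velCrd e c t j * velCrd e c t k := by
  rw [← val_sum_frame, ← mfderiv_symm_eq_sum_frame]
  -- The base points `c t` and `e.symm (e (c t))` are only propositionally equal, so the base point
  -- is generalized, with vectors in the common model space.
  have key : ∀ q : M, q = c t → ∀ u w : EuclideanSpace ℝ (Fin n), u = w →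
      g.val (c t) u u = g.val q w w := by
    rintro q rfl u w rfl
    rfl
  exact key _ (e.left_inv ht) _ _ (velocity_eq_mfderiv_symm he hc ht)

/-! ### Metric compatibility and the connection coefficients of the Jacobi metric -/

theorem sum_christoffel_mul_gram (g : SemiRiemannianMetric n M univ)
    {x : EuclideanSpace ℝ (Fin n)} (hG : IsUnit (gram g e x).det) (i j k : Fin n) :
    ∑ h, christoffel g e h j k x * gram g e x i h =
      (1 / 2) * (pd j (fun z ↦ gram g e z i k) x + pd k (fun z ↦ gram g e z i j) x
        - pd i (fun z ↦ gram g e z j k) x) := by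
  set A : Fin n → ℝ := fun l ↦ pd j (fun z ↦ gram g e z l k) x + pd k (fun z ↦ gram g e z l j) x
      - pd l (fun z ↦ gram g e z j k) x with hA
  have h1 : (gram g e x).mulVec ((gram g e x)⁻¹.mulVec A) = A := by
    rw [Matrix.mulVec_mulVec, Matrix.mul_nonsing_inv _ hG, Matrix.one_mulVec]
  have h2 := congrFun h1 i
  simp only [Matrix.mulVec, dotProduct] at h2
  change _ = 1 / 2 * A i
  rw [← h2, Finset.mul_sum]
  refine Finset.sum_congr rfl fun h _ ↦ ?_
  unfold christoffel
  ring

/-- This is ∇g = 0: in the sum of the two lowered Christoffel symbols all derivatives but ∂_k g_ij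
cancel by symmetry of g. -/
theorem pd_gram_eq (g : SemiRiemannianMetric n M univ)
    {x : EuclideanSpace ℝ (Fin n)} (hG : IsUnit (gram g e x).det) (i j k : Fin n) :
    pd k (fun z ↦ gram g e z i j) x =
      ∑ h, christoffel g e h k i x * gram g e x h j
        + ∑ h, christoffel g e h k j x * gram g e x i h := by
  simp only [gram_symm g x _ j]
  rw [sum_christoffel_mul_gram g hG, sum_christoffel_mul_gram g hG]
  simp only [gram_symm g _ j i, gram_symm g _ j k, gram_symm g _ k i]
  ring

/-- The helicity term is constant in y, so the Berwald connection of N does not see F. -/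
theorem pd_lorentzN (g : SemiRiemannianMetric n M univ) (X : VField n M) (i j k : Fin n)
    (x y : EuclideanSpace ℝ (Fin n)) :
    pd k (fun w ↦ lorentzN g X e j i x w) y = christoffel g e i j k x := by
  have h : HasFDerivAt (fun w ↦ lorentzN g X e j i x w)
      (∑ l, christoffel g e i j l x •
        (EuclideanSpace.proj l : EuclideanSpace ℝ (Fin n) →L[ℝ] ℝ)) y := by
    unfold lorentzN
    refine HasFDerivAt.sub_const _ (HasFDerivAt.fun_sum fun l _ ↦ ?_)
    exact ((EuclideanSpace.proj l : EuclideanSpace ℝ (Fin n) →L[ℝ] ℝ).hasFDerivAt).const_mul _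
  rw [pd, h.fderiv]
  simp [sum_apply]

variable {g : SemiRiemannianMetric n M univ} {X : VField n M} {hX : IsSmoothVField X} {H₀ : ℝ}

theorem gram_jacobiMetric (x : EuclideanSpace ℝ (Fin n)) (i j : Fin n) :
    gram (jacobiMetric g X hX H₀) e x i j = (H₀ + energy g X (e.symm x)) * gram g e x i j :=
  rfl

theorem inv_gram_jacobiMetric {x : EuclideanSpace ℝ (Fin n)}
    (h0 : H₀ + energy g X (e.symm x) ≠ 0) (hG : IsUnit (gram g e x).det) (i j : Fin n) :
    (gram (jacobiMetric g X hX H₀) e x)⁻¹ i j =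
      (H₀ + energy g X (e.symm x))⁻¹ * (gram g e x)⁻¹ i j := by
  have h : gram (jacobiMetric g X hX H₀) e x = (Units.mk0 _ h0) • gram g e x := rfl
  rw [h, Matrix.inv_smul' _ _ hG]
  rfl

theorem pd_gram_jacobiMetric (he : e ∈ IsManifold.maximalAtlas (𝓡 n) ∞ M)
    {x : EuclideanSpace ℝ (Fin n)} (hx : x ∈ e.target) (i j k : Fin n) :
    pd k (fun z ↦ gram (jacobiMetric g X hX H₀) e z i j) x =
      pd k (fun z ↦ energy g X (e.symm z)) x * gram g e x i j
        + (H₀ + energy g X (e.symm x)) * pd k (fun z ↦ gram g e z i j) x := by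
  have hφ := differentiableAt_comp_symm he (energy_smooth g X hX) hx
  simp only [gram_jacobiMetric]
  rw [pd_mul (hφ.const_add H₀) (differentiableAt_gram g he i j hx)]
  congr 2
  simp [pd]

theorem christoffel_jacobiMetric (he : e ∈ IsManifold.maximalAtlas (𝓡 n) ∞ M)
    {x : EuclideanSpace ℝ (Fin n)} (hx : x ∈ e.target)
    (h0 : H₀ + energy g X (e.symm x) ≠ 0) (i j k : Fin n) :
    christoffel (jacobiMetric g X hX H₀) e i j k x = christoffel g e i j k x
      + (2 * (H₀ + energy g X (e.symm x)))⁻¹ * ∑ l, (gram g e x)⁻¹ i l *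
        (pd k (fun z ↦ energy g X (e.symm z)) x * gram g e x l j
          + pd j (fun z ↦ energy g X (e.symm z)) x * gram g e x l k
          - pd l (fun z ↦ energy g X (e.symm z)) x * gram g e x j k) := by
  unfold christoffel
  simp only [pd_gram_jacobiMetric he hx, inv_gram_jacobiMetric h0 (isUnit_det_gram g he hx)]
  simp only [Finset.mul_sum, ← Finset.sum_add_distrib]
  refine Finset.sum_congr rfl fun l _ ↦ ?_
  field_simp
  ring

/-- By the product rule and ∇g = 0, only the derivative of the conformal factor remains. -/
theorem hDeriv_jacobiMetric (he : e ∈ IsManifold.maximalAtlas (𝓡 n) ∞ M)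
    {x : EuclideanSpace ℝ (Fin n)} (hx : x ∈ e.target) (i j k : Fin n)
    (y : EuclideanSpace ℝ (Fin n)) :
    hDeriv (jacobiMetric g X hX H₀) (lorentzN g X) e i j k x y =
      pd k (fun z ↦ energy g X (e.symm z)) x * gram g e x i j := by
  unfold hDeriv
  rw [pd_gram_jacobiMetric he hx]
  simp only [pd_lorentzN, gram_jacobiMetric]
  rw [pd_gram_eq g (isUnit_det_gram g he hx)]
  simp only [mul_left_comm _ (H₀ + energy g X (e.symm x)), ← Finset.mul_sum]
  ring

theorem hChristoffel_jacobiMetric (he : e ∈ IsManifold.maximalAtlas (𝓡 n) ∞ M)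
    {x : EuclideanSpace ℝ (Fin n)} (hx : x ∈ e.target)
    (h0 : H₀ + energy g X (e.symm x) ≠ 0) (i j k : Fin n) (y : EuclideanSpace ℝ (Fin n)) :
    hChristoffel (jacobiMetric g X hX H₀) (lorentzN g X) e i j k x y =
      (2 * (H₀ + energy g X (e.symm x)))⁻¹ * ∑ l, (gram g e x)⁻¹ i l *
        (pd k (fun z ↦ energy g X (e.symm z)) x * gram g e x l j
          + pd j (fun z ↦ energy g X (e.symm z)) x * gram g e x l k
          - pd l (fun z ↦ energy g X (e.symm z)) x * gram g e x j k) := by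
  unfold hChristoffel
  simp only [hDeriv_jacobiMetric he hx, inv_gram_jacobiMetric h0 (isUnit_det_gram g he hx)]
  simp only [Finset.mul_sum]
  refine Finset.sum_congr rfl fun l _ ↦ ?_
  field_simp

end GeomDyn

/-! ### Cancellation on the energy level -/

namespace GeomDyn

variable {n : ℕ} {M : Type*} [TopologicalSpace M] [ChartedSpace (EuclideanSpace ℝ (Fin n)) M]
  [IsManifold (𝓡 n) ∞ M] {e : OpenPartialHomeomorph M (EuclideanSpace ℝ (Fin n))}
  {g : SemiRiemannianMetric n M univ} {X : VField n M} {H₀ : ℝ} {c : ℝ → M} {t : ℝ}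

/-- On the energy level `H₀`, the difference of the Levi-Civita connections of `(H₀ + f) g` and of
`g`, evaluated twice on the velocity. -/
theorem sum_jacobi_correction_of_hamiltonian (hX : IsSmoothVField X)
    (he : e ∈ IsManifold.maximalAtlas (𝓡 n) ∞ M) (hc : ContMDiffAt 𝓘(ℝ, ℝ) (𝓡 n) ∞ c t)
    (ht : c t ∈ e.source) (hH : hamiltonian g X c t = H₀) (h0 : H₀ + energy g X (c t) ≠ 0)
    (i : Fin n) :
    ∑ j, ∑ k, ((2 * (H₀ + energy g X (c t)))⁻¹ * ∑ l, (gram g e (e (c t)))⁻¹ i l *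
        (pd k (fun z ↦ energy g X (e.symm z)) (e (c t)) * gram g e (e (c t)) l j
          + pd j (fun z ↦ energy g X (e.symm z)) (e (c t)) * gram g e (e (c t)) l k
          - pd l (fun z ↦ energy g X (e.symm z)) (e (c t)) * gram g e (e (c t)) j k))
        * velCrd e c t j * velCrd e c t k =
      velCrd e c t i * deriv (fun r ↦ H₀ + energy g X (c r)) t * (H₀ + energy g X (c t))⁻¹
        - gradCoeff g (energy g X) e i (e (c t)) := by
  have h1 := sum_conformal_christoffel_mul_mul (isUnit_det_gram g he (e.map_source ht))
    (velCrd e c t) (fun k ↦ pd k (fun z ↦ energy g X (e.symm z)) (e (c t))) i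
  -- The only use of energy conservation: g(v, v) = 2h cancels the prefactor 1/(2h) of the gradient
  -- term.
  have h2 : ∑ j, ∑ k, gram g e (e (c t)) j k * velCrd e c t j * velCrd e c t k =
      2 * (H₀ + energy g X (c t)) := by
    rw [← val_velocity g he hc ht, ← hH, hamiltonian]
    ring
  have h3 : deriv (fun r ↦ H₀ + energy g X (c r)) t =
      ∑ k, pd k (fun z ↦ energy g X (e.symm z)) (e (c t)) * velCrd e c t k := by
    rw [← deriv_comp_curve he (energy_smooth g X hX) hc ht]
    simp
  rw [h2, ← h3] at h1
  simp only [mul_assoc, ← Finset.mul_sum] at h1 ⊢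
  rw [h1, gradCoeff]
  field_simp

theorem contDiffOn_energy_comp (hX : IsSmoothVField X) {J : Set ℝ}
    (hc : ContMDiffOn 𝓘(ℝ, ℝ) (𝓡 n) ∞ c J) :
    ContDiffOn ℝ ∞ (fun r ↦ H₀ + energy g X (c r)) J :=
  contDiffOn_const.add ((energy_smooth g X hX).comp_contMDiffOn hc).contDiffOn

/-- The parameter of the Jacobi metric, `dt/ds = 1 / (H₀ + f)`, on the energy level `H₀`. -/
structure IsJacobiReparam (g : SemiRiemannianMetric n M univ) (X : VField n M) (H₀ : ℝ) (c : ℝ → M)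
    (τ : ℝ → ℝ) (J' J : Set ℝ) : Prop extends IsReparam τ J' J where
  hasDerivAt : ∀ s ∈ J', HasDerivAt τ (H₀ + energy g X (c (τ s)))⁻¹ s

theorem exists_isJacobiReparam (hX : IsSmoothVField X) {J : Set ℝ} (hJ : IsOpen J)
    (hJ' : J.OrdConnected) (hc : ContMDiffOn 𝓘(ℝ, ℝ) (𝓡 n) ∞ c J)
    (hU : MapsTo c J (jacobiDomain g X H₀)) :
    ∃ (τ : ℝ → ℝ) (J' : Set ℝ), IsJacobiReparam g X H₀ c τ J' J := by
  obtain ⟨τ, J', h1, h2⟩ := exists_isReparam_hasDerivAt_inv hJ hJ'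
    (contDiffOn_energy_comp (g := g) (H₀ := H₀) hX hc) fun t ht ↦ (hU ht).2
  exact ⟨τ, J', h1, h2⟩

theorem IsJacobiReparam.deriv_crd_comp {τ : ℝ → ℝ} {J' J : Set ℝ}
    (hτ : IsJacobiReparam g X H₀ c τ J' J) (hX : IsSmoothVField X) {s : ℝ} (hs : s ∈ J')
    (he : e ∈ IsManifold.maximalAtlas (𝓡 n) ∞ M) (hc : ContMDiffAt 𝓘(ℝ, ℝ) (𝓡 n) ∞ c (τ s))
    (ht : c (τ s) ∈ e.source) (h0 : H₀ + energy g X (c (τ s)) ≠ 0) (i : Fin n) :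
    deriv (crd e (c ∘ τ) i) s =
        velCrd e c (τ s) i * (H₀ + energy g X (c (τ s)))⁻¹ ∧
    deriv (deriv (crd e (c ∘ τ) i)) s =
        deriv (deriv (crd e c i)) (τ s) * (H₀ + energy g X (c (τ s)))⁻¹ ^ 2
        - velCrd e c (τ s) i * deriv (fun r ↦ H₀ + energy g X (c r)) (τ s)
          * (H₀ + energy g X (c (τ s)))⁻¹ ^ 3 := by
  have hh : DifferentiableAt ℝ (fun r ↦ H₀ + energy g X (c r)) (τ s) :=
    (((energy_smooth g X hX).contMDiffAt.comp (τ s) hc).contDiffAt.differentiableAt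
      (by simp)).const_add H₀
  rw [← deriv_crd he hc ht]
  refine deriv_comp_of_hasDerivAt_inv (contDiffAt_crd he hc ht i) hh h0 ?_
  filter_upwards [hτ.isOpen.mem_nhds hs] with r hr using hτ.hasDerivAt r hr

theorem IsPotentialTrajectory.isPregeodesicOn {I J : Set ℝ} (h : IsPotentialTrajectory g X c I)
    (hI : IsOpen I) (hX : IsSmoothVField X) (hH : ∀ t ∈ I, hamiltonian g X c t = H₀) (hJI : J ⊆ I)
    (hJ : IsOpen J) (hJ' : J.OrdConnected) (hU : MapsTo c J (jacobiDomain g X H₀)) :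
    IsPregeodesicOn (jacobiMetric g X hX H₀) c J := by
  have hcJ := h.1.mono hJI
  refine ⟨hcJ, ?_⟩
  obtain ⟨τ, J', hτ⟩ := exists_isJacobiReparam hX hJ hJ' hcJ hU
  have hτJ : MapsTo τ J' J := hτ.image_eq ▸ mapsTo_image τ J'
  refine ⟨τ, J', hτ.toIsReparam, hcJ.comp hτ.smooth.contMDiffOn hτJ, hU.comp hτJ, ?_⟩
  intro s hs e he hes i
  have hes' : c (τ s) ∈ e.source := hes
  have ht := hJI (hτJ hs)
  have hc := h.1.contMDiffAt (hI.mem_nhds ht)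
  have h0 := (hU (hτJ hs)).2
  have h0' : H₀ + energy g X (e.symm (e (c (τ s)))) ≠ 0 := by rwa [e.left_inv hes']
  have key := sum_jacobi_correction_of_hamiltonian hX he hc hes' (hH _ ht) h0 i
  have hacc := h.2 _ ht e he hes' i
  unfold accel at hacc ⊢
  simp only [deriv_crd he hc hes'] at hacc
  simp only [(hτ.deriv_crd_comp hX hs he hc hes' h0 _).1,
    (hτ.deriv_crd_comp hX hs he hc hes' h0 _).2, Function.comp_apply,
    christoffel_jacobiMetric he (e.map_source hes') h0', e.left_inv hes']
  have hsum : ∀ A B : Fin n → Fin n → ℝ, ∀ v : Fin n → ℝ, ∀ q : ℝ,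
      ∑ j, ∑ k, (A j k + B j k) * (v j * q) * (v k * q) =
        q ^ 2 * (∑ j, ∑ k, A j k * v j * v k + ∑ j, ∑ k, B j k * v j * v k) := by
    intro A B v q
    simp only [Finset.mul_sum, ← Finset.sum_add_distrib]
    exact Finset.sum_congr rfl fun j _ ↦ Finset.sum_congr rfl fun k _ ↦ by ring
  rw [hsum, key]
  -- The h' terms of `key` and of the chain rule cancel; what is left is h⁻² times the equation of
  -- motion.
  linear_combination (H₀ + energy g X (c (τ s)))⁻¹ ^ 2 * hacc

theorem IsNonPotentialTrajectory.isHorizontalPregeodesicOn {I J : Set ℝ}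
    (h : IsNonPotentialTrajectory g X c I) (hI : IsOpen I) (hX : IsSmoothVField X)
    (hH : ∀ t ∈ I, hamiltonian g X c t = H₀) (hJI : J ⊆ I) (hJ : IsOpen J)
    (hJ' : J.OrdConnected) (hU : MapsTo c J (jacobiDomain g X H₀)) :
    IsHorizontalPregeodesicOn (jacobiMetric g X hX H₀) (lorentzN g X) c J := by
  have hcJ := h.1.mono hJI
  refine ⟨hcJ, hU, ?_⟩
  obtain ⟨τ, J', hτ⟩ := exists_isJacobiReparam hX hJ hJ' hcJ hU
  have hτJ : MapsTo τ J' J := hτ.image_eq ▸ mapsTo_image τ J'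
  refine ⟨τ, J', hτ.toIsReparam, ?_⟩
  intro s hs e he hes i
  have ht := hJI (hτJ hs)
  have hc := h.1.contMDiffAt (hI.mem_nhds ht)
  have h0 := (hU (hτJ hs)).2
  have h0' : H₀ + energy g X (e.symm (e (c (τ s)))) ≠ 0 := by rwa [e.left_inv hes]
  have key := sum_jacobi_correction_of_hamiltonian hX he hc hes (hH _ ht) h0 i
  have hacc := h.2 _ ht e he hes i
  unfold accel at hacc
  unfold hAccel
  simp only [deriv_crd he hc hes] at hacc
  simp only [(hτ.deriv_crd_comp hX hs he hc hes h0 _).1,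
    (hτ.deriv_crd_comp hX hs he hc hes h0 _).2, (hτ.hasDerivAt s hs).deriv,
    hChristoffel_jacobiMetric he (e.map_source hes) h0', e.left_inv hes, lorentzN]
  have hsum : ∀ B : Fin n → Fin n → ℝ, ∀ v : Fin n → ℝ, ∀ q : ℝ,
      ∑ j, ∑ k, B j k * (v j * q) * (v k * q) = q ^ 2 * ∑ j, ∑ k, B j k * v j * v k := by
    intro B v q
    simp only [Finset.mul_sum]
    exact Finset.sum_congr rfl fun j _ ↦ Finset.sum_congr rfl fun k _ ↦ by ring
  -- With `q` = 1/h, one factor comes from dt/ds and one from dx/ds, as N is evaluated at dx/dt.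
  -- Hence the Γ and F parts both scale by h⁻², although F is only linear in the velocity.
  have hN : ∀ A : Fin n → Fin n → ℝ, ∀ F v : Fin n → ℝ, ∀ q : ℝ,
      q * ∑ j, (∑ k, A j k * v k - F j) * (v j * q) =
        q ^ 2 * (∑ j, ∑ k, A j k * v j * v k - ∑ j, F j * v j) := by
    intro A F v q
    rw [← Finset.sum_sub_distrib, Finset.mul_sum, Finset.mul_sum]
    refine Finset.sum_congr rfl fun j _ ↦ ?_
    have : ∑ k, A j k * v j * v k = v j * ∑ k, A j k * v k := by
      rw [Finset.mul_sum]
      exact Finset.sum_congr rfl fun k _ ↦ by ring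
    rw [this]
    ring
  rw [hsum, hN, key]
  linear_combination (H₀ + energy g X (c (τ s)))⁻¹ ^ 2 * hacc

end GeomDyn

end

theorem mainTheorem1 (n : ℕ) (M : Type*) [TopologicalSpace M]
    [ChartedSpace (EuclideanSpace ℝ (Fin n)) M] [IsManifold (𝓡 n) ∞ M]
    (g : SemiRiemannianMetric n M Set.univ) (X : VField n M) (hX : IsSmoothVField X) (H₀ : ℝ)
    (I : Set ℝ) (hI : IsOpen I) (hI' : I.OrdConnected) (c : ℝ → M)
    (hnonconst : ∃ t₁ ∈ I, ∃ t₂ ∈ I, c t₁ ≠ c t₂)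
    (hH : ∀ t ∈ I, GeomDyn.hamiltonian g X c t = H₀) :
    (GeomDyn.IsPotentialTrajectory g X c I →
      ∀ J ⊆ I, IsOpen J → J.OrdConnected → Set.MapsTo c J (GeomDyn.jacobiDomain g X H₀) →
        GeomDyn.IsPregeodesicOn (GeomDyn.jacobiMetric g X hX H₀) c J) ∧
    (GeomDyn.IsNonPotentialTrajectory g X c I →
      ∀ J ⊆ I, IsOpen J → J.OrdConnected → Set.MapsTo c J (GeomDyn.jacobiDomain g X H₀) →
        GeomDyn.IsHorizontalPregeodesicOn (GeomDyn.jacobiMetric g X hX H₀)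
          (GeomDyn.lorentzN g X) c J) :=
  ⟨fun h _ hJI hJ hJ' hU ↦ h.isPregeodesicOn hI hX hH hJI hJ hJ' hU,
    fun h _ hJI hJ hJ' hU ↦ h.isHorizontalPregeodesicOn hI hX hH hJI hJ hJ' hU⟩
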